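/- Let $Y$ be a finite simple undirected graph. Let $S_Y$ be the set of words in which every vertex of $Y$ occurs exactly once. Let $\sim_Y$ be the equivalence relation on $S_Y$ generated by interchanging two consecutive entries of a word that are not joined by an edge of $Y$, and write $[\pi]_Y$ for the class of $\pi$. For $\pi=(\pi_1,\dots,\pi_n)\in S_Y$ put $\boldsymbol\sigma_1(\pi)=(\pi_2,\dots,\pi_n,\pi_1)$ and $\boldsymbol\rho(\pi)=(\pi_n,\dots,\pi_2,\pi_1)$. Let $C(Y)$ be the graph with vertex set $S_Y/\!\sim_Y$ and edges $\{[\pi]_Y,[\boldsymbol\sigma_1(\pi)]_Y\}$ for $\pi\in S_Y$, and let $D(Y)$ be the graph obtained from $C(Y)$ by adding the edges $\{[\pi]_Y,[\boldsymbol\rho(\pi)]_Y\}$ for $\pi\in S_Y$. Let $\kappa(Y)$ and $\delta(Y)$ be the numbers of connected components of $C(Y)$ and $D(Y)$, respectively, and let $\alpha(Y)$ be the number of acyclic orientations of $Y$. Let $Y\oplus v$ be the graph obtained from $Y$ by adding a new vertex $v$ and joining it to every vertex of $Y$. If $Y$ has at least one edge, then $$\kappa(Y\oplus v)=2\,\delta(Y\oplus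 v)=\alpha(Y).$$ -/

import Mathlib

namespace SDS

variable {V : Type*}

/-- The update graph on all words over the vertex set: two distinct words are adjacent when they
differ only by a transposition of two consecutive entries that do not form an edge of `Y`. -/
def wordUpdateGraph (Y : SimpleGraph V) : SimpleGraph (List V) where
  Adj w w' := w ≠ w' ∧ ∃ (l r : List V) (a b : V),
    w = l ++ a :: b :: r ∧ w' = l ++ b :: a :: r ∧ s(a, b) ∉ Y.edgeSet
  symm := ⟨by
    rintro w w' ⟨hne, l, r, a, b, hw, hw', hab⟩
    exact ⟨hne.symm, l, r, b, a, hw', hw, by rwa [Sym2.eq_swap]⟩⟩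
  loopless := ⟨fun _ h => h.1 rfl⟩

/-- The set of permutation update orders: words in which every vertex occurs exactly once. -/
def updateOrders (V : Type*) : Set (List V) := {w | w.Nodup ∧ ∀ v, v ∈ w}

/-- The permutation update graph `U(Y)`. -/
def updateGraph (Y : SimpleGraph V) : SimpleGraph (updateOrders V) :=
  (wordUpdateGraph Y).induce (updateOrders V)

/-- The set of equivalence classes of update orders under `∼_Y`, that is, of connected components
of `U(Y)`. -/
abbrev UpdateClass (Y : SimpleGraph V) : Type _ := (updateGraph Y).ConnectedComponent

/-- The equivalence class `[π]_Y`. -/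
abbrev updateClass (Y : SimpleGraph V) (π : updateOrders V) : UpdateClass Y :=
  (updateGraph Y).connectedComponentMk π

/-- The shift `(π₁, π₂, …, πₙ) ↦ (π₂, …, πₙ, π₁)`. -/
def shift (π : updateOrders V) : updateOrders V :=
  ⟨π.1.rotate 1, List.nodup_rotate.2 π.2.1, fun v => List.mem_rotate.2 (π.2.2 v)⟩

/-- The reflection `(π₁, π₂, …, πₙ) ↦ (πₙ, …, π₂, π₁)`. -/
def reflect (π : updateOrders V) : updateOrders V :=
  ⟨π.1.reverse, List.nodup_reverse.2 π.2.1, fun v => List.mem_reverse.2 (π.2.2 v)⟩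

/-- The graph `C(Y)` on the equivalence classes of update orders, with edges
`{[π]_Y, [shift π]_Y}` (loops, which do not affect connectivity, are discarded). -/
def shiftGraph (Y : SimpleGraph V) : SimpleGraph (UpdateClass Y) :=
  SimpleGraph.fromEdgeSet
    (Set.range fun π : updateOrders V => s(updateClass Y π, updateClass Y (shift π)))

/-- The graph `D(Y)` on the equivalence classes of update orders, with edges
`{[π]_Y, [reflect π]_Y}` in addition to those of `C(Y)`. -/
def dihedralGraph (Y : SimpleGraph V) : SimpleGraph (UpdateClass Y) :=
  SimpleGraph.fromEdgeSet
    ((Set.range fun π : updateOrders V => s(updateClass Y π, updateClass Y (reflect π))) ∪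
      (shiftGraph Y).edgeSet)

/-- `κ(Y)`, the number of connected components of `C(Y)`. -/
noncomputable def kappa (Y : SimpleGraph V) : ℕ := Nat.card (shiftGraph Y).ConnectedComponent

/-- `δ(Y)`, the number of connected components of `D(Y)`. -/
noncomputable def delta (Y : SimpleGraph V) : ℕ := Nat.card (dihedralGraph Y).ConnectedComponent

/-- An orientation of `Y` sends each edge `{i, j}` to either `(i, j)` or `(j, i)`. -/
def IsOrientation (Y : SimpleGraph V) (O : Y.edgeSet → V × V) : Prop :=
  ∀ e : Y.edgeSet, s((O e).1, (O e).2) = e.1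

/-- No directed cycles: no vertex is reached from itself by a directed walk of positive length. -/
def IsAcyclicOrientation (Y : SimpleGraph V) (O : Y.edgeSet → V × V) : Prop :=
  IsOrientation Y O ∧ ∀ v : V, ¬ Relation.TransGen (fun i j => ∃ e, O e = (i, j)) v v

/-- `α(Y)`, the number of acyclic orientations of `Y`. -/
noncomputable def alpha (Y : SimpleGraph V) : ℕ :=
  Nat.card {O : Y.edgeSet → V × V // IsAcyclicOrientation Y O}

/-- The vertex-join of `Y` with a new vertex (`none`): the new vertex is joined to every vertex
of `Y`. -/
def vertexJoin (Y : SimpleGraph V) : SimpleGraph (Option V) where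
  Adj
    | some i, some j => Y.Adj i j
    | some _, none => True
    | none, some _ => True
    | none, none => False
  symm := ⟨by
    rintro (_ | i) (_ | j) h
    · exact h
    · trivial
    · trivial
    · exact Y.adj_symm h⟩
  loopless := ⟨by
    rintro (_ | i) h
    · exact h
    · exact Y.irrefl h⟩

end SDS

/-! A word orients every edge of `Y` forwards. Swapping non-adjacent neighbours leaves this
orientation unchanged, and the words compatible with a fixed acyclic orientation are joined by such
swaps, so update classes of `Y` correspond to acyclic orientations (`updateClassEquiv`).

In a word over `vertexJoin Y` the new vertex `none` takes part in no admissible swap, being joined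
to everything, so only shifts carry it round. Reading the word cyclically from just after `none`
gives an update order of `Y` whose class is invariant under swaps and shifts, and rotating `none` to
the front shows that this class is a complete invariant (`kappa_vertexJoin`).

Reflection commutes with this cutting, so the components of the dihedral graph are the orbits of
reflection on the update classes of `Y`. Reflection reverses every edge, so one edge suffices for it
to have no fixed class; every orbit then has two elements, whence the factor 2. -/

namespace SDS

/-! ### Invariants of connected components -/

section Components

variable {W α : Type*} {G : SimpleGraph W}

/-- A function constant along the edges is constant on connected components. -/
theorem eq_of_reachable (f : W → α) (hf : ∀ a b, G.Adj a b → f a = f b) {a b : W}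
    (h : G.Reachable a b) : f a = f b := by
  obtain ⟨p⟩ := h
  induction p with
  | nil => rfl
  | cons h _ ih => exact (hf _ _ h).trans ih

/-- Descend a function constant along the edges to the connected components. -/
def liftComponent (f : W → α) (hf : ∀ a b, G.Adj a b → f a = f b) : G.ConnectedComponent → α :=
  Quot.lift f fun _ _ h => eq_of_reachable f hf h

theorem reachable_fromEdgeSet {s : Set (Sym2 W)} {a b : W} (h : s(a, b) ∈ s) :
    (SimpleGraph.fromEdgeSet s).Reachable a b := by
  by_cases hab : a = b
  · rw [hab]
  · exact SimpleGraph.Adj.reachable ((SimpleGraph.fromEdgeSet_adj s).2 ⟨h, hab⟩)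

end Components

variable {V : Type*} {Y : SimpleGraph V}

/-! ### Words -/

theorem wordUpdateGraph_adj_iff {w w' : List V} : (wordUpdateGraph Y).Adj w w' ↔
    w ≠ w' ∧ ∃ (l r : List V) (a b : V),
      w = l ++ a :: b :: r ∧ w' = l ++ b :: a :: r ∧ ¬ Y.Adj a b := by
  simp [wordUpdateGraph]

theorem reachable_swap {a b : V} (hab : ¬ Y.Adj a b) (l r : List V) :
    (wordUpdateGraph Y).Reachable (l ++ a :: b :: r) (l ++ b :: a :: r) := by
  by_cases h : l ++ a :: b :: r = l ++ b :: a :: r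
  · rw [h]
  · exact SimpleGraph.Adj.reachable (wordUpdateGraph_adj_iff.2 ⟨h, l, r, a, b, rfl, rfl, hab⟩)

theorem reachable_of_reachable_map {W W' : Type*} {G : SimpleGraph W} {H : SimpleGraph W'}
    (f : W → W') (hf : ∀ a b, G.Adj a b → H.Reachable (f a) (f b)) {a b : W}
    (h : G.Reachable a b) : H.Reachable (f a) (f b) := by
  obtain ⟨p⟩ := h
  induction p with
  | nil => rfl
  | cons h _ ih => exact (hf _ _ h).trans ih

theorem reachable_cons (x : V) {w w' : List V} (h : (wordUpdateGraph Y).Reachable w w') :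
    (wordUpdateGraph Y).Reachable (x :: w) (x :: w') := by
  refine reachable_of_reachable_map (x :: ·) (fun w w' h => ?_) h
  obtain ⟨-, l, r, a, b, rfl, rfl, hab⟩ := wordUpdateGraph_adj_iff.1 h
  exact reachable_swap hab (x :: l) r

theorem reachable_move_front (x : V) (l r : List V) (h : ∀ y ∈ l, ¬ Y.Adj x y) :
    (wordUpdateGraph Y).Reachable (x :: (l ++ r)) (l ++ x :: r) := by
  induction l with
  | nil => rfl
  | cons y l ih =>
    exact (reachable_swap (h y (by simp)) [] (l ++ r)).trans
      (reachable_cons y (ih fun z hz => h z (by simp [hz])))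

theorem perm_of_adj {w w' : List V} (h : (wordUpdateGraph Y).Adj w w') : w.Perm w' := by
  obtain ⟨-, l, r, a, b, rfl, rfl, -⟩ := wordUpdateGraph_adj_iff.1 h
  exact (List.Perm.swap b a r).append_left l

theorem mem_updateOrders_of_perm {w w' : List V} (h : w.Perm w') (hw : w ∈ updateOrders V) :
    w' ∈ updateOrders V :=
  ⟨h.nodup_iff.1 hw.1, fun v => h.mem_iff.1 (hw.2 v)⟩

theorem perm_of_mem_updateOrders {w w' : List V} (hw : w ∈ updateOrders V)
    (hw' : w' ∈ updateOrders V) : w.Perm w' :=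
  (List.perm_ext_iff_of_nodup hw.1 hw'.1).2 fun v => iff_of_true (hw.2 v) (hw'.2 v)

/-- Swaps permute the letters, so a walk of words that starts at an update order never leaves the
update orders. -/
theorem updateGraph_reachable {π π' : updateOrders V}
    (h : (wordUpdateGraph Y).Reachable π.1 π'.1) : (updateGraph Y).Reachable π π' := by
  obtain ⟨w, hw⟩ := π
  obtain ⟨w', hw'⟩ := π'
  obtain ⟨p⟩ := h
  dsimp only at p
  induction p with
  | nil => rfl
  | cons h _ ih =>
    have hv := mem_updateOrders_of_perm (perm_of_adj h) hw
    refine SimpleGraph.Reachable.trans (SimpleGraph.Adj.reachable (v := ⟨_, hv⟩) ?_) (ih hv hw')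
    exact h

theorem updateClass_eq_of_swap {π π' : updateOrders V} {l r : List V} {a b : V}
    (h : π.1 = l ++ a :: b :: r) (h' : π'.1 = l ++ b :: a :: r) (hab : ¬ Y.Adj a b) :
    updateClass Y π = updateClass Y π' := by
  refine SimpleGraph.ConnectedComponent.sound (updateGraph_reachable ?_)
  rw [h, h']
  exact reachable_swap hab l r

theorem exists_swap_of_adj {π π' : updateOrders V} (h : (updateGraph Y).Adj π π') :
    ∃ (l r : List V) (a b : V),
      π.1 = l ++ a :: b :: r ∧ π'.1 = l ++ b :: a :: r ∧ ¬ Y.Adj a b :=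
  (wordUpdateGraph_adj_iff.1 h).2

/-! ### Words compatible with an orientation -/

/-- No edge is directed backwards along the word `w`. -/
def Compatible (O : Y.edgeSet → V × V) (w : List V) : Prop :=
  w.Pairwise fun i j => ∀ e, O e ≠ (j, i)

theorem Compatible.swap {O : Y.edgeSet → V × V} (hO : IsOrientation Y O) {l r : List V} {a b : V}
    (hab : ¬ Y.Adj a b) (h : Compatible O (l ++ a :: b :: r)) :
    Compatible O (l ++ b :: a :: r) := by
  have hba : ∀ e, O e ≠ (a, b) := by
    intro e he
    have h1 := hO e
    rw [he] at h1
    have h2 := e.2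
    rw [← h1] at h2
    exact hab h2
  unfold Compatible at *
  simp only [List.pairwise_append, List.pairwise_cons, List.mem_cons] at *
  grind

/-- A neighbour of the first letter `x` of `w` standing before `x` in `w'` would give an edge that
one of the two words directs backwards. Hence `x` passes freely to the front of `w'`, and induction
treats the rest. -/
theorem reachable_of_compatible {O : Y.edgeSet → V × V} (hO : IsOrientation Y O) {w w' : List V}
    (hw : w.Nodup) (hp : w.Perm w') (h : Compatible O w) (h' : Compatible O w') :
    (wordUpdateGraph Y).Reachable w w' := by
  induction w generalizing w' with
  | nil => rw [List.nil_perm.1 hp]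
  | cons x t ih =>
    obtain ⟨l, r, rfl⟩ := List.append_of_mem (hp.mem_iff.1 (List.mem_cons_self))
    have hp' : t.Perm (l ++ r) := (hp.trans List.perm_middle).cons_inv
    unfold Compatible at h h' ih
    have hl : ∀ y ∈ l, ¬ Y.Adj x y := by
      intro y hy hxy
      have hyt : y ∈ t := hp'.mem_iff.2 (by simp [hy])
      have h1 := (List.pairwise_cons.1 h).1 y hyt ⟨s(x, y), hxy⟩
      have h2 := (List.pairwise_append.1 h').2.2 y hy x (by simp) ⟨s(x, y), hxy⟩
      have h3 := hO ⟨s(x, y), hxy⟩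
      rcases Sym2.eq_iff.1 h3 with ⟨h4, h5⟩ | ⟨h4, h5⟩
      · exact h2 (Prod.ext h4 h5)
      · exact h1 (Prod.ext h4 h5)
    refine (reachable_cons x (ih (List.nodup_cons.1 hw).2 hp' (List.pairwise_cons.1 h).2 ?_)).trans
      (reachable_move_front x l r hl)
    exact h'.sublist ((List.sublist_cons_self x r).append_left l)

theorem Compatible.eq {O O' : Y.edgeSet → V × V} (hO : IsOrientation Y O)
    (hO' : IsOrientation Y O') {w : List V} (hw : ∀ v, v ∈ w) (h : Compatible O w)
    (h' : Compatible O' w) : O = O' := by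
  funext e
  by_contra hne
  have h1 : O' e = ((O e).2, (O e).1) := by
    have h2 := (hO e).trans (hO' e).symm
    rcases Sym2.eq_iff.1 h2 with ⟨h4, h5⟩ | ⟨h4, h5⟩
    · exact absurd (Prod.ext h4 h5) hne
    · exact Prod.ext h5.symm h4.symm
  have hadj : (O e).1 ≠ (O e).2 := by
    intro hh
    exact hne (by rw [h1]; exact Prod.ext hh hh.symm)
  -- If the orientations differ at `e`, neither order of its endpoints is allowed in `w`. The
  -- relation is symmetric, so it passes from ordered pairs of positions to any two distinct
  -- letters.
  have h3 : w.Pairwise fun i j => ¬ (O e = (j, i) ∨ O e = (i, j)) := by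
    refine (List.Pairwise.and h h').imp ?_
    rintro i j ⟨ha, hb⟩ (hc | hc)
    · exact ha e hc
    · exact hb e (by rw [h1, hc])
  have : Std.Symm fun i j => ¬ (O e = (j, i) ∨ O e = (i, j)) := ⟨fun i j hij hc => hij hc.symm⟩
  exact h3.forall (hw (O e).1) (hw (O e).2) hadj (Or.inr rfl)

theorem exists_orientation_compatible {w : List V} (hw : w ∈ updateOrders V) :
    ∃ O : Y.edgeSet → V × V, IsAcyclicOrientation Y O ∧ Compatible O w := by
  classical
  have key : ∀ e : Y.edgeSet, ∃ p : V × V, s(p.1, p.2) = e.1 ∧ w.idxOf p.1 < w.idxOf p.2 := by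
    rintro ⟨e, he⟩
    induction e with
    | _ i j =>
      have hne : w.idxOf i ≠ w.idxOf j := fun h =>
        (SimpleGraph.Adj.ne he) ((List.idxOf_inj (hw.2 i)).1 h)
      rcases lt_or_gt_of_ne hne with h | h
      · exact ⟨(i, j), rfl, h⟩
      · exact ⟨(j, i), Sym2.eq_swap, h⟩
  choose O hO1 hO2 using key
  refine ⟨O, ⟨hO1, fun v hv => ?_⟩, ?_⟩
  -- Positions in `w` strictly increase along directed walks, which rules out cycles.
  · have : ∀ u v, Relation.TransGen (fun i j => ∃ e, O e = (i, j)) u v →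
        w.idxOf u < w.idxOf v := by
      intro u v h
      induction h with
      | single h => obtain ⟨e, he⟩ := h; simpa [he] using hO2 e
      | tail _ h ih => obtain ⟨e, he⟩ := h; exact ih.trans (by simpa [he] using hO2 e)
    exact lt_irrefl _ (this v v hv)
  · refine List.pairwise_iff_getElem.2 fun i j hi hj hij e he => ?_
    have h := hO2 e
    rw [he] at h
    simp only [hw.1.idxOf_getElem] at h
    omega

theorem exists_compatible [Finite V] {O : Y.edgeSet → V × V} (hO : IsAcyclicOrientation Y O) :
    ∃ w ∈ updateOrders V, Compatible O w := by
  classical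
  cases nonempty_fintype V
  let R : V → V → Prop := fun i j => ∃ e, O e = (i, j)
  have : IsPartialOrder V (Relation.ReflTransGen R) :=
    { refl := fun _ => Relation.ReflTransGen.refl
      trans := fun _ _ _ => Relation.ReflTransGen.trans
      antisymm := by
        intro a b hab hba
        rcases Relation.reflTransGen_iff_eq_or_transGen.1 hab with h | h
        · exact h.symm
        · exact absurd (h.trans_left hba) (hO.2 a) }
  -- Acyclicity makes directed reachability a partial order; listing the vertices along a linear
  -- extension gives the word.
  obtain ⟨s, hs, hle⟩ := extend_partialOrder (Relation.ReflTransGen R)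
  refine ⟨Finset.univ.sort s, ⟨Finset.sort_nodup _ _, by simp⟩, ?_⟩
  refine (Finset.pairwise_sort Finset.univ s).imp fun {i j} hij e he => ?_
  have hji : s j i := hle j i (Relation.ReflTransGen.single ⟨e, he⟩)
  have hEq : i = j := hs.antisymm _ _ hij hji
  subst hEq
  exact hO.2 i (Relation.TransGen.single ⟨e, he⟩)

/-- The acyclic orientation that directs every edge forwards along the word `π`. -/
noncomputable def orient (Y : SimpleGraph V) (π : updateOrders V) :
    {O : Y.edgeSet → V × V // IsAcyclicOrientation Y O} :=
  ⟨_, (exists_orientation_compatible (Y := Y) π.2).choose_spec.1⟩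

theorem orient_compatible (π : updateOrders V) : Compatible (orient Y π).1 π.1 :=
  (exists_orientation_compatible (Y := Y) π.2).choose_spec.2

theorem orient_eq {π : updateOrders V} {O : {O : Y.edgeSet → V × V // IsAcyclicOrientation Y O}}
    (h : Compatible O.1 π.1) : orient Y π = O :=
  Subtype.ext ((orient_compatible π).eq (orient Y π).2.1 O.2.1 π.2.2 h)

theorem orient_eq_of_adj (π π' : updateOrders V) (h : (updateGraph Y).Adj π π') :
    orient Y π = orient Y π' := by
  symm
  apply orient_eq
  obtain ⟨l, r, a, b, h1, h2, hab⟩ := exists_swap_of_adj h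
  have hc := orient_compatible (Y := Y) π
  rw [h1] at hc
  rw [h2]
  exact hc.swap (orient Y π).2.1 hab

theorem updateClass_eq_iff {π π' : updateOrders V} :
    updateClass Y π = updateClass Y π' ↔ orient Y π = orient Y π' := by
  constructor
  · intro h
    exact eq_of_reachable _ orient_eq_of_adj (SimpleGraph.ConnectedComponent.exact h)
  · intro h
    refine SimpleGraph.ConnectedComponent.sound (updateGraph_reachable ?_)
    refine reachable_of_compatible (orient Y π).2.1 π.2.1 (perm_of_mem_updateOrders π.2 π'.2)
      (orient_compatible π) ?_
    rw [h]
    exact orient_compatible π'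

/-- Update classes correspond to acyclic orientations. -/
noncomputable def updateClassEquiv [Finite V] (Y : SimpleGraph V) :
    UpdateClass Y ≃ {O : Y.edgeSet → V × V // IsAcyclicOrientation Y O} :=
  Equiv.ofBijective (liftComponent (orient Y) orient_eq_of_adj) <| by
    constructor
    · intro c c'
      induction c using SimpleGraph.ConnectedComponent.ind with | _ π
      induction c' using SimpleGraph.ConnectedComponent.ind with | _ π'
      exact updateClass_eq_iff.2
    · intro O
      obtain ⟨w, hw, h⟩ := exists_compatible O.2
      exact ⟨updateClass Y ⟨w, hw⟩, orient_eq h⟩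

/-! ### Reflection of update classes -/

theorem updateClass_reflect_eq_of_adj (π π' : updateOrders V) (h : (updateGraph Y).Adj π π') :
    updateClass Y (reflect π) = updateClass Y (reflect π') := by
  obtain ⟨l, r, a, b, h1, h2, hab⟩ := exists_swap_of_adj h
  refine updateClass_eq_of_swap (l := r.reverse) (r := l.reverse) (a := b) (b := a) ?_ ?_
    fun h => hab h.symm
  · simp [reflect, h1]
  · simp [reflect, h2]

/-- The reflection of an update class. -/
def reflectClass (Y : SimpleGraph V) : UpdateClass Y → UpdateClass Y :=
  liftComponent (fun π => updateClass Y (reflect π)) updateClass_reflect_eq_of_adj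

theorem reflectClass_mk (π : updateOrders V) :
    reflectClass Y (updateClass Y π) = updateClass Y (reflect π) := rfl

theorem reflectClass_reflectClass (c : UpdateClass Y) :
    reflectClass Y (reflectClass Y c) = c := by
  induction c using SimpleGraph.ConnectedComponent.ind with | _ π
  rw [reflectClass_mk, reflectClass_mk]
  congr 1
  exact Subtype.ext (List.reverse_reverse _)

/-- On a fixed class, one orientation would be compatible with both a word and its reverse, leaving
no possible order for the endpoints of an edge. -/
theorem reflectClass_ne (hY : Y.edgeSet.Nonempty) (c : UpdateClass Y) : reflectClass Y c ≠ c := by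
  induction c using SimpleGraph.ConnectedComponent.ind with | _ π
  intro h
  obtain ⟨e, he⟩ := hY
  have h1 := orient_compatible (Y := Y) (reflect π)
  rw [updateClass_eq_iff.1 h] at h1
  have h2 := orient_compatible (Y := Y) π
  set O := (orient Y π) with hO
  have h3 := List.pairwise_reverse.1 h1
  have h4 : π.1.Pairwise fun i j => ¬ (O.1 ⟨e, he⟩ = (j, i) ∨ O.1 ⟨e, he⟩ = (i, j)) := by
    refine (List.Pairwise.and h2 h3).imp ?_
    rintro i j ⟨ha, hb⟩ (hc | hc)
    · exact ha _ hc
    · exact hb _ hc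
  have hadj : Y.Adj (O.1 ⟨e, he⟩).1 (O.1 ⟨e, he⟩).2 := by
    have h5 := O.2.1 ⟨e, he⟩
    change s((O.1 ⟨e, he⟩).1, (O.1 ⟨e, he⟩).2) ∈ Y.edgeSet
    rw [h5]
    exact he
  have : Std.Symm fun i j => ¬ (O.1 ⟨e, he⟩ = (j, i) ∨ O.1 ⟨e, he⟩ = (i, j)) :=
    ⟨fun i j hij hc => hij hc.symm⟩
  exact h4.forall (π.2.2 _) (π.2.2 _) hadj.ne (Or.inr rfl)

/-! ### Cutting words over the vertex-join at the new vertex -/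

theorem exists_eq_map_some {w : List (Option V)} (h : none ∉ w) :
    ∃ l : List V, w = l.map some := by
  induction w with
  | nil => exact ⟨[], rfl⟩
  | cons x w ih =>
    obtain ⟨l, rfl⟩ := ih fun h' => h (List.mem_cons_of_mem _ h')
    cases x with
    | none => simp at h
    | some x => exact ⟨x :: l, rfl⟩

theorem exists_split (π : updateOrders (Option V)) :
    ∃ l r : List V, π.1 = l.map some ++ none :: r.map some := by
  obtain ⟨w, hw⟩ := π
  obtain ⟨l, r, rfl⟩ := List.append_of_mem (hw.2 none)
  have h := List.nodup_middle.1 hw.1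
  rw [List.nodup_cons, List.mem_append, not_or] at h
  obtain ⟨l, rfl⟩ := exists_eq_map_some h.1.1
  obtain ⟨r, rfl⟩ := exists_eq_map_some h.1.2
  exact ⟨l, r, rfl⟩

/-- The word read cyclically after `none`. -/
def cutWord (w : List (Option V)) : List V :=
  (w.dropWhile Option.isSome ++ w.takeWhile Option.isSome).reduceOption

theorem cutWord_split (l r : List V) : cutWord (l.map some ++ none :: r.map some) = r ++ l := by
  have h1 : (l.map some ++ none :: r.map some).dropWhile Option.isSome = none :: r.map some := by
    induction l <;> simp_all
  have h2 : (l.map some ++ none :: r.map some).takeWhile Option.isSome = l.map some := by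
    induction l <;> simp_all
  rw [cutWord, h1, h2]
  simp [List.reduceOption]

theorem mem_updateOrders_split {l r : List V} :
    l.map some ++ none :: r.map some ∈ updateOrders (Option V) ↔ r ++ l ∈ updateOrders V := by
  constructor
  · rintro ⟨h1, h2⟩
    have h := (List.nodup_cons.1 (List.nodup_middle.1 h1)).2
    rw [← List.map_append] at h
    refine ⟨List.nodup_append_comm.1 h.of_map, fun v => ?_⟩
    have := h2 (some v)
    simp at this
    simp [or_comm, this]
  · rintro ⟨h1, h2⟩
    constructor
    · rw [List.nodup_middle, ← List.map_append]
      exact List.nodup_cons.2 ⟨by simp,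
        (List.nodup_append_comm.1 h1).map (Option.some_injective V)⟩
    · rintro (_ | v)
      · simp
      · have := h2 v
        simp at this
        simpa using this.symm

/-- The update order of `V` read cyclically after `none`. -/
def cut (π : updateOrders (Option V)) : updateOrders V :=
  ⟨cutWord π.1, by
    obtain ⟨l, r, h⟩ := exists_split π
    have hp := π.2
    rw [h] at hp ⊢
    rw [cutWord_split]
    exact mem_updateOrders_split.1 hp⟩

/-- Put `none` in front of an update order. -/
def extend (π : updateOrders V) : updateOrders (Option V) :=
  ⟨none :: π.1.map some, mem_updateOrders_split (l := []).2 (by simp [π.2])⟩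

theorem cut_eq {π : updateOrders (Option V)} {l r : List V}
    (h : π.1 = l.map some ++ none :: r.map some) : (cut π).1 = r ++ l := by
  change cutWord π.1 = _
  rw [h, cutWord_split]

theorem cut_extend (π : updateOrders V) : cut (extend π) = π :=
  Subtype.ext ((cut_eq (l := []) rfl).trans (List.append_nil _))

theorem cut_shift (π : updateOrders (Option V)) : cut (shift π) = cut π := by
  obtain ⟨l, r, h⟩ := exists_split π
  apply Subtype.ext
  rw [cut_eq h]
  cases l with
  | nil =>
    -- Here `none` is the first letter and the shift carries it to the end.
    rw [cut_eq (l := r) (r := [])]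
    · simp
    · simp [shift, h]
  | cons x l =>
    rw [cut_eq (l := l) (r := r ++ [x])]
    · simp
    · simp [shift, h]

theorem cut_reflect (π : updateOrders (Option V)) : cut (reflect π) = reflect (cut π) := by
  obtain ⟨l, r, h⟩ := exists_split π
  apply Subtype.ext
  rw [cut_eq (l := r.reverse) (r := l.reverse)]
  · simp [reflect, cut_eq h]
  · simp [reflect, h]

/-- The swapped pair avoids `none`, so it lies wholly on one side of it and stays consecutive after
cutting. -/
theorem updateClass_cut_eq_of_adj (π π' : updateOrders (Option V))
    (h : (updateGraph (vertexJoin Y)).Adj π π') :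
    updateClass Y (cut π) = updateClass Y (cut π') := by
  obtain ⟨l, r, a, b, h1, h2, hab⟩ := exists_swap_of_adj h
  have hnd := π.2.1
  rw [h1] at hnd
  have hne : a ≠ b := by
    rintro rfl
    simp [List.nodup_append] at hnd
  obtain ⟨a, rfl⟩ | ha := Option.eq_none_or_eq_some a |>.symm
  swap
  · subst ha
    cases b with
    | none => exact absurd rfl hne
    | some b => exact absurd trivial hab
  cases b with
  | none => exact absurd trivial hab
  | some b =>
    have hab : ¬ Y.Adj a b := hab
    have hmem : none ∈ l ++ some a :: some b :: r := h1 ▸ π.2.2 none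
    simp only [List.mem_append, List.mem_cons, reduceCtorEq, false_or] at hmem
    rcases hmem with hm | hm
    · obtain ⟨l₁, l₂, rfl⟩ := List.append_of_mem hm
      have hn : none ∉ l₁ ∧ none ∉ l₂ ∧ none ∉ r := by
        simp only [List.append_assoc, List.cons_append] at hnd
        have := (List.nodup_cons.1 (List.nodup_middle.1 hnd)).1
        simpa using this
      obtain ⟨l₁, rfl⟩ := exists_eq_map_some hn.1
      obtain ⟨l₂, rfl⟩ := exists_eq_map_some hn.2.1
      obtain ⟨r, rfl⟩ := exists_eq_map_some hn.2.2
      refine updateClass_eq_of_swap (l := l₂) (r := r ++ l₁) (a := a) (b := b) ?_ ?_ hab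
      · rw [cut_eq (l := l₁) (r := l₂ ++ a :: b :: r)] <;> simp [h1]
      · rw [cut_eq (l := l₁) (r := l₂ ++ b :: a :: r)] <;> simp [h2]
    · obtain ⟨r₁, r₂, rfl⟩ := List.append_of_mem hm
      have hn : none ∉ l ∧ none ∉ r₁ ∧ none ∉ r₂ := by
        rw [show l ++ some a :: some b :: (r₁ ++ none :: r₂) =
          (l ++ some a :: some b :: r₁) ++ none :: r₂ by simp] at hnd
        have := (List.nodup_cons.1 (List.nodup_middle.1 hnd)).1
        simpa [and_assoc] using this
      obtain ⟨l, rfl⟩ := exists_eq_map_some hn.1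
      obtain ⟨r₁, rfl⟩ := exists_eq_map_some hn.2.1
      obtain ⟨r₂, rfl⟩ := exists_eq_map_some hn.2.2
      refine updateClass_eq_of_swap (l := r₂ ++ l) (r := r₁) (a := a) (b := b) ?_ ?_ hab
      · rw [cut_eq (l := l ++ a :: b :: r₁) (r := r₂)] <;> simp [h1]
      · rw [cut_eq (l := l ++ b :: a :: r₁) (r := r₂)] <;> simp [h2]

/-- Cutting at the new vertex, on update classes. -/
def cutClass (Y : SimpleGraph V) : UpdateClass (vertexJoin Y) → UpdateClass Y :=
  liftComponent (fun π => updateClass Y (cut π)) updateClass_cut_eq_of_adj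

theorem updateClass_extend_eq_of_adj (π π' : updateOrders V) (h : (updateGraph Y).Adj π π') :
    updateClass (vertexJoin Y) (extend π) = updateClass (vertexJoin Y) (extend π') := by
  obtain ⟨l, r, a, b, h1, h2, hab⟩ := exists_swap_of_adj h
  refine updateClass_eq_of_swap (l := none :: l.map some) (r := r.map some) (a := some a)
    (b := some b) ?_ ?_ hab
  · simp [extend, h1]
  · simp [extend, h2]

/-- Putting the new vertex in front, on update classes. -/
def extendClass (Y : SimpleGraph V) : UpdateClass Y → UpdateClass (vertexJoin Y) :=
  liftComponent (fun π => updateClass (vertexJoin Y) (extend π)) updateClass_extend_eq_of_adj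

theorem cutClass_extendClass (c : UpdateClass Y) : cutClass Y (extendClass Y c) = c := by
  induction c using SimpleGraph.ConnectedComponent.ind with | _ π
  exact congrArg (updateClass Y) (cut_extend π)

/-! ### Components of the shift graph -/

theorem shiftGraph_reachable_rotate (Z : SimpleGraph V) (n : ℕ) (π π' : updateOrders V)
    (h : π'.1 = π.1.rotate n) :
    (shiftGraph Z).Reachable (updateClass Z π) (updateClass Z π') := by
  induction n generalizing π with
  | zero =>
    have : π' = π := Subtype.ext (by simpa using h)
    rw [this]
  | succ n ih =>
    refine SimpleGraph.Reachable.trans (reachable_fromEdgeSet ⟨π, rfl⟩) (ih (shift π) ?_)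
    rw [h, shift, List.rotate_rotate, Nat.add_comm]

theorem shiftGraph_reachable_extendClass (c : UpdateClass (vertexJoin Y)) :
    (shiftGraph (vertexJoin Y)).Reachable c (extendClass Y (cutClass Y c)) := by
  induction c using SimpleGraph.ConnectedComponent.ind with | _ π
  obtain ⟨l, r, h⟩ := exists_split π
  -- Rotating past the `l.length` letters before `none` brings `none` to the front.
  refine shiftGraph_reachable_rotate _ l.length π (extend (cut π)) ?_
  change none :: (cut π).1.map some = _
  rw [cut_eq h, h]
  have := List.rotate_append_length_eq (l.map (some : V → Option V)) (none :: r.map some)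
  rw [List.length_map] at this
  rw [this]
  simp

theorem cutClass_eq_of_adj (c c' : UpdateClass (vertexJoin Y))
    (h : (shiftGraph (vertexJoin Y)).Adj c c') : cutClass Y c = cutClass Y c' := by
  obtain ⟨⟨π, hπ⟩, -⟩ := (SimpleGraph.fromEdgeSet_adj _).1 h
  have key : cutClass Y (updateClass _ π) = cutClass Y (updateClass _ (shift π)) :=
    (congrArg (updateClass Y) (cut_shift π)).symm
  rcases Sym2.eq_iff.1 hπ with ⟨rfl, rfl⟩ | ⟨rfl, rfl⟩
  · exact key
  · exact key.symm

theorem kappa_vertexJoin (Y : SimpleGraph V) :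
    kappa (vertexJoin Y) = Nat.card (UpdateClass Y) := by
  symm
  refine Nat.card_congr (Equiv.ofBijective
    (fun c => (shiftGraph (vertexJoin Y)).connectedComponentMk (extendClass Y c)) ⟨?_, ?_⟩)
  · intro c c' h
    have := eq_of_reachable _ cutClass_eq_of_adj (SimpleGraph.ConnectedComponent.exact h)
    rwa [cutClass_extendClass, cutClass_extendClass] at this
  · intro d
    induction d using SimpleGraph.ConnectedComponent.ind with | _ c
    exact ⟨cutClass Y c,
      (SimpleGraph.ConnectedComponent.sound (shiftGraph_reachable_extendClass c)).symm⟩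

/-! ### Components of the dihedral graph -/

theorem shiftGraph_le_dihedralGraph (Z : SimpleGraph V) : shiftGraph Z ≤ dihedralGraph Z := by
  intro c c' h
  exact (SimpleGraph.fromEdgeSet_adj _).2 ⟨Or.inr h, h.ne⟩

theorem cutClass_reflectClass (c : UpdateClass (vertexJoin Y)) :
    cutClass Y (reflectClass _ c) = reflectClass Y (cutClass Y c) := by
  induction c using SimpleGraph.ConnectedComponent.ind with | _ π
  exact congrArg (updateClass Y) (cut_reflect π)

theorem dihedralGraph_reachable_reflectClass (Z : SimpleGraph V) (c : UpdateClass Z) :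
    (dihedralGraph Z).Reachable c (reflectClass Z c) := by
  induction c using SimpleGraph.ConnectedComponent.ind with | _ π
  exact reachable_fromEdgeSet (Or.inl ⟨π, rfl⟩)

/-- An update class together with its reflection. -/
def reflectPair (Y : SimpleGraph V) (c : UpdateClass Y) : Sym2 (UpdateClass Y) :=
  s(c, reflectClass Y c)

theorem reflectPair_reflectClass (c : UpdateClass Y) :
    reflectPair Y (reflectClass Y c) = reflectPair Y c := by
  rw [reflectPair, reflectClass_reflectClass, Sym2.eq_swap, reflectPair]

/-- The unordered pair is the invariant that survives reflection edges as well as shift edges; it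
tells the components of the dihedral graph apart. -/
theorem reflectPair_eq_of_adj (c c' : UpdateClass (vertexJoin Y))
    (h : (dihedralGraph (vertexJoin Y)).Adj c c') :
    reflectPair Y (cutClass Y c) = reflectPair Y (cutClass Y c') := by
  obtain ⟨⟨π, hπ⟩ | h, -⟩ := (SimpleGraph.fromEdgeSet_adj _).1 h
  · have key : reflectPair Y (cutClass Y (updateClass _ π)) =
        reflectPair Y (cutClass Y (updateClass _ (reflect π))) := by
      rw [← reflectClass_mk, cutClass_reflectClass, reflectPair_reflectClass]
    rcases Sym2.eq_iff.1 hπ with ⟨rfl, rfl⟩ | ⟨rfl, rfl⟩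
    · exact key
    · exact key.symm
  · rw [cutClass_eq_of_adj c c' h]

/-- The component of the dihedral graph of the vertex-join that belongs to an update class. -/
def dihedralComponent (Y : SimpleGraph V) (c : UpdateClass Y) :
    (dihedralGraph (vertexJoin Y)).ConnectedComponent :=
  (dihedralGraph (vertexJoin Y)).connectedComponentMk (extendClass Y c)

theorem dihedralComponent_surjective (Y : SimpleGraph V) :
    Function.Surjective (dihedralComponent Y) := by
  intro d
  induction d using SimpleGraph.ConnectedComponent.ind with | _ c
  exact ⟨cutClass Y c, (SimpleGraph.ConnectedComponent.sound
    ((shiftGraph_reachable_extendClass c).mono (shiftGraph_le_dihedralGraph _))).symm⟩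

theorem dihedralComponent_eq_iff {c c' : UpdateClass Y} :
    dihedralComponent Y c = dihedralComponent Y c' ↔ c = c' ∨ c = reflectClass Y c' := by
  constructor
  · intro h
    have := eq_of_reachable _ reflectPair_eq_of_adj (SimpleGraph.ConnectedComponent.exact h)
    rw [cutClass_extendClass, cutClass_extendClass] at this
    rcases Sym2.eq_iff.1 this with h | h
    · exact Or.inl h.1
    · exact Or.inr h.1
  · rintro (rfl | rfl)
    · rfl
    · refine (SimpleGraph.ConnectedComponent.sound ?_).symm
      refine (dihedralGraph_reachable_reflectClass _ _).trans ?_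
      -- Reflection sends the leading `none` to the end; shifts bring it back to the front.
      have := shiftGraph_reachable_extendClass (reflectClass _ (extendClass Y c'))
      rw [cutClass_reflectClass, cutClass_extendClass] at this
      exact this.mono (shiftGraph_le_dihedralGraph _)

theorem two_mul_delta_vertexJoin [Finite V] (hY : Y.edgeSet.Nonempty) :
    2 * delta (vertexJoin Y) = Nat.card (UpdateClass Y) := by
  classical
  have : Finite (UpdateClass Y) := Finite.of_equiv _ (updateClassEquiv Y).symm
  have : Finite (dihedralGraph (vertexJoin Y)).ConnectedComponent :=
    Finite.of_surjective _ (dihedralComponent_surjective Y)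
  cases nonempty_fintype (UpdateClass Y)
  cases nonempty_fintype (dihedralGraph (vertexJoin Y)).ConnectedComponent
  -- Each fibre is a reflection orbit, of size exactly two because no class is fixed.
  have hfiber : ∀ d ∈ (Finset.univ : Finset (dihedralGraph (vertexJoin Y)).ConnectedComponent),
      (Finset.univ.filter fun c => dihedralComponent Y c = d).card = 2 := by
    intro d _
    obtain ⟨c', rfl⟩ := dihedralComponent_surjective Y d
    rw [Finset.card_eq_two]
    refine ⟨c', reflectClass Y c', (reflectClass_ne hY c').symm, ?_⟩
    ext c
    simp [dihedralComponent_eq_iff]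
  have h := Finset.card_eq_sum_card_fiberwise (s := (Finset.univ : Finset (UpdateClass Y)))
    (f := dihedralComponent Y) (t := Finset.univ) (fun _ _ => by simp)
  rw [Finset.sum_congr rfl hfiber, Finset.sum_const, Finset.card_univ, Finset.card_univ] at h
  rw [delta, Nat.card_eq_fintype_card, Nat.card_eq_fintype_card, h, smul_eq_mul, mul_comm]

end SDS

theorem proposition5 {V : Type*} [Finite V] (Y : SimpleGraph V) (hY : Y.edgeSet.Nonempty) :
    SDS.kappa (SDS.vertexJoin Y) = 2 * SDS.delta (SDS.vertexJoin Y) ∧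
      2 * SDS.delta (SDS.vertexJoin Y) = SDS.alpha Y := by
  rw [SDS.kappa_vertexJoin, SDS.two_mul_delta_vertexJoin hY]
  exact ⟨rfl, Nat.card_congr (SDS.updateClassEquiv Y)⟩
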